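/- Let $n\ge 1$, let $\mathbb E_n$ be the $n$-dimensional Euclidean space and let $\mathbb G_n=\mathcal C\ell(n,0,0)$ be its Clifford algebra, so that $\mathbf v\mathbf v=\mathbf v\cdot\mathbf v$ for $\mathbf v\in\mathbb E_n\subseteq\mathbb G_n$. For vectors put $\mathbf u_1\wedge\cdots\wedge\mathbf u_k=\frac1{k!}\sum_{\sigma\in S_k}\operatorname{sgn}(\sigma)\,\mathbf u_{\sigma(1)}\cdots\mathbf u_{\sigma(k)}\in\mathbb G_n$ (equal to $1$ for $k=0$). For points $\mathbf a_1,\dots,\mathbf a_{n+1}\in\mathbb E_n$ put $$\Delta=(\mathbf a_2-\mathbf a_1)\wedge\cdots\wedge(\mathbf a_{n+1}-\mathbf a_1),$$ and for $1\le i\le n-1$ let $\overline{\mathbf a_i}$ be the reflection of $\mathbf a_i$ through the affine subspace spanned by $\mathbf a_{i+1},\dots,\mathbf a_{n+1}$. Put $$\overline\Delta=\bigwedge_{j=1}^{n-1}(\overline{\mathbf a_j}-\mathbf a_j),\qquad \overline{\Delta^i}=\Big(\bigwedge_{1\le j\le n-1,\ j\ne i}(\overline{\mathbf a_j}-\mathbf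 a_j)\Big)\wedge(\mathbf a_{n+1}-\mathbf a_n)\quad(1\le i\le n-1),$$ and, for a real function $f$, $$\overline\Delta f=\frac1{2^{n-1}}\Big\{\sum_{i=1}^{n-1}(-1)^{i+1}\big[f(\overline{\mathbf a_i})-f(\mathbf a_i)\big]\overline{\Delta^i}+(-1)^{n+1}\big[f(\mathbf a_{n+1})-f(\mathbf a_n)\big]\overline\Delta\Big\}.$$ Let $\Omega\subseteq\mathbb E_n$, let $\mathbf x_0$ be an interior point of $\Omega$, and let $f:\Omega\to\mathbb R$ (extended arbitrarily outside $\Omega$) be strongly differentiable at $\mathbf x_0$: there is $\mathbf g\in\mathbb E_n$ such that for each $\epsilon>0$ there is $\delta>0$ with $|f(\mathbf u)-f(\mathbf v)-\mathbf g\cdot(\mathbf u-\mathbf v)|\le\epsilon|\mathbf u-\mathbf v|$ for all $\mathbf u,\mathbf v\in\Omega$ with $|\mathbf u-\mathbf x_0|<\delta$ and $|\mathbf v-\mathbf x_0|<\delta$. Then, whenever $\Delta\neq0$, the element $\Delta$ is invertible in $\mathbb G_n$ and the Clifford quotient $(\overline\Delta f)\,\Delta^{-1}$ is a vector of $\mathbb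 E_n$, and $$\lim_{\substack{(\mathbf a_1,\dots,\mathbf a_{n+1})\to(\mathbf x_0,\dots,\mathbf x_0)\\ \Delta\ne0}}(\overline\Delta f)\,\Delta^{-1}=\nabla f(\mathbf x_0).$$ -/

import Mathlib

open Filter Topology
open scoped Gradient

noncomputable section

namespace CliffordSecant

/-- The `n`-dimensional Euclidean space. -/
abbrev E (n : ℕ) : Type := EuclideanSpace ℝ (Fin n)

/-- The quadratic form `v ↦ v · v` on the Euclidean space. -/
def normForm (n : ℕ) : QuadraticForm ℝ (E n) :=
  LinearMap.BilinMap.toQuadraticMap (innerₗ (E n))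

theorem normForm_apply {n : ℕ} (v : E n) : normForm n v = inner ℝ v v := rfl

/-- The Clifford geometric algebra `Cℓ(n,0,0)` of the Euclidean space, in which `v * v = v · v`. -/
abbrev G (n : ℕ) : Type := CliffordAlgebra (normForm n)

/-- The embedding of vectors in the geometric algebra. -/
def vec {n : ℕ} : E n →ₗ[ℝ] G n := CliffordAlgebra.ι (normForm n)

/-- The outer product `u₁ ∧ ⋯ ∧ uₖ` of vectors in the geometric algebra, that is
`(1 / k!) ∑ σ, sign σ • u_{σ 1} ⋯ u_{σ k}` (geometric products); it is `1` for `k = 0`. -/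
def wedge {n k : ℕ} (u : Fin k → E n) : G n :=
  ((k.factorial : ℝ)⁻¹) •
    ∑ σ : Equiv.Perm (Fin k),
      ((Equiv.Perm.sign σ : ℤ) : ℝ) • (List.ofFn fun i => vec (u (σ i))).prod

/-- Strong (strict) differentiability at `x₀` of a function defined on `Ω`
(the values of `f` outside `Ω` play no role). -/
def StronglyDifferentiableAt {n : ℕ} (Ω : Set (E n)) (f : E n → ℝ) (x₀ : E n) : Prop :=
  ∃ g : E n, ∀ ε > 0, ∃ δ > 0, ∀ u ∈ Ω, ∀ v ∈ Ω, ‖u - x₀‖ < δ → ‖v - x₀‖ < δ →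
    |f u - f v - inner ℝ g (u - v)| ≤ ε * ‖u - v‖

section Simplex

/-! Below, the dimension is `n = m + 1`. The `n + 1` vertices `a₁, …, a_{n+1}` are
`a 0, …, a (m + 1)`, and there are `n - 1 = m` mirrored points. -/

variable {m : ℕ}

/-- The pseudo-scalar `Δ = (a₂ - a₁) ∧ ⋯ ∧ (a_{n+1} - a₁)`. -/
def pseudoScalar (a : Fin (m + 2) → E (m + 1)) : G (m + 1) :=
  wedge fun i : Fin (m + 1) => a i.succ - a 0

/-- The affine subspace through all the vertices that come after the vertex of index `i`. -/
def laterFlat (a : Fin (m + 2) → E (m + 1)) (i : Fin m) : AffineSubspace ℝ (E (m + 1)) :=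
  affineSpan ℝ (a '' {j | i.castSucc.castSucc < j})

instance (a : Fin (m + 2) → E (m + 1)) (i : Fin m) : Nonempty (laterFlat a i) :=
  ⟨⟨a (Fin.last (m + 1)),
    subset_affineSpan ℝ _ ⟨_, Fin.castSucc_lt_last i.castSucc, rfl⟩⟩⟩

/-- The mirrored point `ā_i`: the reflection of `a_i` through the affine subspace spanned by
`a_{i+1}, …, a_{n+1}`, for `1 ≤ i ≤ n - 1`. -/
def mirrored (a : Fin (m + 2) → E (m + 1)) (i : Fin m) : E (m + 1) :=
  EuclideanGeometry.reflection (laterFlat a i) (a i.castSucc.castSucc)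

/-- The `n - 1` vectors `ā_i - a_i`. -/
def diagonal (a : Fin (m + 2) → E (m + 1)) (i : Fin m) : E (m + 1) :=
  mirrored a i - a i.castSucc.castSucc

/-- The vector `a_{n+1} - a_n`. -/
def lastEdge (a : Fin (m + 2) → E (m + 1)) : E (m + 1) :=
  a (Fin.last (m + 1)) - a (Fin.last m).castSucc

/-- The blade `(ā_1 - a_1) ∧ ⋯ ∧ (ā_{n-1} - a_{n-1})`. -/
def mirrorBlade (a : Fin (m + 2) → E (m + 1)) : G (m + 1) :=
  wedge (diagonal a)

/-- The blade obtained from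
`(ā_1 - a_1) ∧ ⋯ ∧ (ā_{n-1} - a_{n-1}) ∧ (a_{n+1} - a_n)` by omitting the factor `ā_i - a_i`. -/
def mirrorBladeOmit (a : Fin (m + 2) → E (m + 1)) (i : Fin m) : G (m + 1) :=
  wedge fun j : Fin m =>
    (Fin.snoc (diagonal a) (lastEdge a) : Fin (m + 1) → E (m + 1)) (i.castSucc.succAbove j)

/-- The mean multi-difference pseudo-vector of `f`. The sign `(-1) ^ (i + 1)` of the 1-based index
`i` is `(-1) ^ i` for the 0-based one, and `(-1) ^ (n + 1) = (-1) ^ m`. -/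
def meanMultiDiff (f : E (m + 1) → ℝ) (a : Fin (m + 2) → E (m + 1)) : G (m + 1) :=
  ((2 : ℝ) ^ m)⁻¹ •
    ((∑ i : Fin m, ((-1 : ℝ) ^ (i : ℕ) * (f (mirrored a i) - f (a i.castSucc.castSucc))) •
        mirrorBladeOmit a i) +
      ((-1 : ℝ) ^ m * (f (a (Fin.last (m + 1))) - f (a (Fin.last m).castSucc))) • mirrorBlade a)

end Simplex

end CliffordSecant

end

/-! Write d_i for the vectors ā_i - a_i, followed by a_{n+1} - a_n. Each d_i is normal to the flat
of the later vertices, whose direction contains every later d_j, so the d_i are pairwise orthogonal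
(`pairwiseOrthogonal_mirroredFrame`) and all wedges in sight are plain geometric products
(`wedge_eq_vecProd`). A unitriangular change of vectors gives d_1 ⋯ d_n = 2^(n-1) Δ
(`wedge_mirroredFrame`). Dividing the signed product without d_i by the whole leaves d_i / |d_i|²,
so the quotient is ∑ (Δ_i f) d_i / |d_i|² (`vec_secantGradient`).

The d_i form an orthogonal basis, so ∇f(x₀) has the same expansion with coefficients ∇f(x₀)·d_i.
Strong differentiability bounds each coefficient error by ε|d_i|, hence each term by ε, whatever the
shape of the simplex. -/

noncomputable section

namespace CliffordSecant

/-! ### Geometric products of orthogonal vectors -/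

section OuterProduct

variable {n k : ℕ}

/-- The outer product as an alternating map. -/
def wedgeMap (n k : ℕ) : E n [⋀^Fin k]→ₗ[ℝ] G n :=
  ((k.factorial : ℝ)⁻¹) • MultilinearMap.alternatization
    ((MultilinearMap.mkPiAlgebraFin ℝ k (G n)).compLinearMap fun _ => vec)

theorem wedgeMap_apply (u : Fin k → E n) : wedgeMap n k u = wedge u := by
  simp only [wedgeMap, wedge, AlternatingMap.smul_apply, MultilinearMap.alternatization_apply,
    MultilinearMap.domDomCongr_apply, MultilinearMap.compLinearMap_apply,
    MultilinearMap.mkPiAlgebraFin_apply]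
  congr 1

theorem vec_mul_self (v : E n) : vec v * vec v = algebraMap ℝ (G n) (‖v‖ ^ 2) := by
  rw [vec, CliffordAlgebra.ι_sq_scalar, normForm_apply, real_inner_self_eq_norm_sq]

theorem vec_mul_comm_of_inner_eq_zero {v w : E n} (h : inner ℝ v w = 0) :
    vec v * vec w = -(vec w * vec v) := by
  refine CliffordAlgebra.ι_mul_ι_comm_of_isOrtho ?_
  rw [QuadraticMap.isOrtho_def]
  simp only [normForm_apply, inner_add_left, inner_add_right, h, real_inner_comm v w]
  ring

theorem isUnit_vec {v : E n} (h : v ≠ 0) : IsUnit (vec v) := by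
  have hv : ‖v‖ ^ 2 ≠ 0 := by positivity
  have hmul : (‖v‖ ^ 2)⁻¹ • (vec v * vec v) = 1 := by
    rw [vec_mul_self, Algebra.algebraMap_eq_smul_one, smul_smul, inv_mul_cancel₀ hv, one_smul]
  exact ⟨⟨vec v, (‖v‖ ^ 2)⁻¹ • vec v, by rw [mul_smul_comm, hmul], by rw [smul_mul_assoc, hmul]⟩,
    rfl⟩

/-- The ordered geometric product of a family of vectors. -/
def vecProd (u : Fin k → E n) : G n := (List.ofFn fun i => vec (u i)).prod

theorem vecProd_succ (u : Fin (k + 1) → E n) :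
    vecProd u = vec (u 0) * vecProd fun i => u i.succ := by
  simp [vecProd, List.ofFn_succ]

theorem isUnit_vecProd {u : Fin k → E n} (h : ∀ i, u i ≠ 0) : IsUnit (vecProd u) := by
  induction k with
  | zero => simp [vecProd]
  | succ k ih =>
    rw [vecProd_succ]
    exact (isUnit_vec (h 0)).mul (ih fun i => h i.succ)

theorem ne_zero_of_vecProd_ne_zero {u : Fin k → E n} (h : vecProd u ≠ 0) (i : Fin k) :
    u i ≠ 0 := by
  intro hi
  refine h (List.prod_eq_zero (List.mem_ofFn.2 ⟨i, ?_⟩))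
  rw [hi, map_zero]

/-- The family `u` consists of pairwise orthogonal vectors. -/
abbrev PairwiseOrthogonal (u : Fin k → E n) : Prop :=
  Pairwise fun i j => inner ℝ (u i) (u j) = 0

theorem PairwiseOrthogonal.comp {l : ℕ} {u : Fin k → E n} (hu : PairwiseOrthogonal u)
    {s : Fin l → Fin k} (hs : s.Injective) : PairwiseOrthogonal fun i => u (s i) :=
  fun _ _ hij => hu (hs.ne hij)

theorem vecProd_swap {u : Fin (k + 1) → E n} (hu : PairwiseOrthogonal u) (i : Fin k) :
    vecProd (fun j => u (Equiv.swap i.castSucc i.succ j)) = -vecProd u := by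
  induction k with
  | zero => exact i.elim0
  | succ k ih =>
    refine Fin.cases ?_ (fun i => ?_) i
    · have h : ∀ j : Fin k, Equiv.swap (0 : Fin (k + 2)) 1 j.succ.succ = j.succ.succ := fun j =>
        Equiv.swap_apply_of_ne_of_ne (Fin.succ_ne_zero _)
          (by rw [← Fin.succ_zero_eq_one]; exact (Fin.succ_injective _).ne (Fin.succ_ne_zero _))
      simp only [vecProd_succ, Fin.castSucc_zero, Fin.succ_zero_eq_one, Equiv.swap_apply_left,
        Equiv.swap_apply_right, h]
      rw [← mul_assoc, ← mul_assoc, vec_mul_comm_of_inner_eq_zero (hu (by simp)), neg_mul]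
    · have h : ∀ j : Fin (k + 1), Equiv.swap i.succ.castSucc i.succ.succ j.succ =
          (Equiv.swap i.castSucc i.succ j).succ := fun j => by
        rw [← Fin.succ_castSucc, (Fin.succ_injective _).map_swap]
      rw [vecProd_succ, vecProd_succ u, Equiv.swap_apply_of_ne_of_ne
        (by rw [← Fin.succ_castSucc]; exact (Fin.succ_ne_zero _).symm) (Fin.succ_ne_zero _).symm]
      simp only [h]
      rw [ih (hu.comp (Fin.succ_injective _)) i, mul_neg]

theorem vecProd_perm (σ : Equiv.Perm (Fin k)) {u : Fin k → E n} (hu : PairwiseOrthogonal u) :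
    vecProd (fun j => u (σ j)) = ((Equiv.Perm.sign σ : ℤ) : ℝ) • vecProd u := by
  cases k with
  | zero => simp [vecProd, Subsingleton.elim σ 1]
  | succ k =>
    have hσ : σ ∈ Submonoid.closure (Set.range fun i : Fin k => Equiv.swap i.castSucc i.succ) := by
      rw [Equiv.Perm.mclosure_swap_castSucc_succ]; trivial
    induction hσ using Submonoid.closure_induction generalizing u with
    | mem _ h =>
      obtain ⟨i, rfl⟩ := h
      rw [vecProd_swap hu, Equiv.Perm.sign_swap i.castSucc_lt_succ.ne]
      simp
    | one => simp
    | mul σ τ _ _ hσ hτ =>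
      have := hτ (hu.comp σ.injective)
      simp only [Equiv.Perm.mul_apply]
      rw [this, hσ hu, smul_smul, Equiv.Perm.sign_mul, mul_comm]
      simp

/-- Orthogonal vectors anticommute, so reordering costs exactly the sign of the permutation; all k!
signed terms coincide. -/
theorem wedge_eq_vecProd {u : Fin k → E n} (hu : PairwiseOrthogonal u) :
    wedge u = vecProd u := by
  have h : ∀ σ : Equiv.Perm (Fin k), ((Equiv.Perm.sign σ : ℤ) : ℝ) •
      (List.ofFn fun i => vec (u (σ i))).prod = vecProd u := fun σ => by
    have := vecProd_perm σ hu
    rw [vecProd] at this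
    rw [this, smul_smul]
    rcases Int.units_eq_one_or (Equiv.Perm.sign σ) with h | h <;> simp [h]
  rw [wedge, Finset.sum_congr rfl fun σ _ => h σ, Finset.sum_const, Finset.card_univ,
    Fintype.card_perm, Fintype.card_fin, ← Nat.cast_smul_eq_nsmul ℝ, smul_smul,
    inv_mul_cancel₀ (by exact_mod_cast k.factorial_ne_zero), one_smul]

theorem vecProd_eq_smul_vec_mul {u : Fin (k + 1) → E n} (hu : PairwiseOrthogonal u)
    (i : Fin (k + 1)) :
    vecProd u = (-1 : ℝ) ^ (i : ℕ) • (vec (u i) * vecProd fun j => u (i.succAbove j)) := by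
  -- This cycle brings the i-th factor to the front past i others.
  have h := vecProd_perm i.cycleRange.symm hu
  rw [vecProd_succ] at h
  simp only [Fin.cycleRange_symm_zero, Fin.cycleRange_symm_succ, Equiv.Perm.sign_symm,
    Fin.sign_cycleRange] at h
  rw [h, smul_smul]
  push_cast
  rw [← mul_pow]; simp

/-- Right division of an orthogonal blade with one factor omitted by the whole blade. -/
theorem smul_vecProd_omit_mul_inverse {u : Fin (k + 1) → E n} (hu : PairwiseOrthogonal u)
    (h0 : ∀ i, u i ≠ 0) (i : Fin (k + 1)) :
    (-1 : ℝ) ^ (i : ℕ) • (vecProd fun j => u (i.succAbove j)) * Ring.inverse (vecProd u) =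
      vec ((‖u i‖ ^ 2)⁻¹ • u i) := by
  have hi : ‖u i‖ ^ 2 ≠ 0 := pow_ne_zero _ (norm_ne_zero_iff.2 (h0 i))
  have hunit : vecProd u * Ring.inverse (vecProd u) = 1 :=
    Ring.mul_inverse_cancel _ (isUnit_vecProd h0)
  -- `u i / ‖u i‖²` is the inverse of `u i`, so it strips that factor once it stands in front.
  have : (-1 : ℝ) ^ (i : ℕ) • (vecProd fun j => u (i.succAbove j)) =
      vec ((‖u i‖ ^ 2)⁻¹ • u i) * vecProd u := by
    rw [vecProd_eq_smul_vec_mul hu i, mul_smul_comm, map_smul, smul_mul_assoc, ← mul_assoc,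
      vec_mul_self, ← Algebra.smul_def, smul_smul, smul_smul, mul_assoc, inv_mul_cancel₀ hi,
      mul_one]
  rw [this, mul_assoc, hunit, mul_one]

end OuterProduct

/-! ### Alternating maps under unitriangular changes -/

section Triangular

variable {R M N ι : Type*} [CommRing R] [AddCommGroup M] [Module R M] [AddCommGroup N]
  [Module R N]

theorem alternatingMap_update_eq_zero_of_mem_span [DecidableEq ι] (f : M [⋀^ι]→ₗ[R] N)
    (v : ι → M) (i : ι) {x : M} (hx : x ∈ Submodule.span R (v '' {j | j ≠ i})) :
    f (Function.update v i x) = 0 := by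
  have : Submodule.span R (v '' {j | j ≠ i}) ≤
      LinearMap.ker (f.toMultilinearMap.toLinearMap v i) := by
    rw [Submodule.span_le]
    rintro _ ⟨j, hj, rfl⟩
    exact f.map_update_self v (Ne.symm hj)
  exact this hx

/-- An alternating map takes the same value on two families that differ by a unitriangular change
of vectors. -/
theorem alternatingMap_eq_of_sub_mem_span_gt [LinearOrder ι] [Fintype ι]
    (f : M [⋀^ι]→ₗ[R] N) {v w : ι → M}
    (h : ∀ i, v i - w i ∈ Submodule.span R (w '' Set.Ioi i)) : f v = f w := by
  suffices ∀ s : Finset ι, f (s.piecewise v w) = f w by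
    simpa using this Finset.univ
  intro s
  -- Entries are exchanged in increasing order: when entry i changes, all later ones are still those
  -- of `w`, so the correction lies in the span of the other entries.
  induction s using Finset.induction_on_max with
  | empty => simp
  | insert i s hs ih =>
    have hi : i ∉ s := fun hi => (hs i hi).false
    have hu : Function.update (s.piecewise v w) i (w i) = s.piecewise v w := by
      conv_rhs => rw [← Function.update_eq_self i (s.piecewise v w)]
      rw [Finset.piecewise_eq_of_notMem _ _ _ hi]
    rw [Finset.piecewise_insert, ← sub_add_cancel (v i) (w i), f.map_update_add, hu, ih,
      alternatingMap_update_eq_zero_of_mem_span, zero_add]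
    refine Submodule.span_mono ?_ (h i)
    rintro _ ⟨j, hj, rfl⟩
    exact ⟨j, (Set.mem_Ioi.1 hj).ne',
      Finset.piecewise_eq_of_notMem _ _ _ fun hjs => (hs j hjs).not_gt hj⟩

theorem alternatingMap_eq_of_sub_mem_span_lt [LinearOrder ι] [Fintype ι]
    (f : M [⋀^ι]→ₗ[R] N) {v w : ι → M}
    (h : ∀ i, v i - w i ∈ Submodule.span R (w '' Set.Iio i)) : f v = f w :=
  alternatingMap_eq_of_sub_mem_span_gt (ι := ιᵒᵈ) f h

end Triangular

/-! ### Orthogonality of the mirrored frame and the quotient formula -/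

section MirroredFrame

variable {m : ℕ}

/-- The vectors `ā_1 - a_1, …, ā_{n-1} - a_{n-1}, a_{n+1} - a_n`. -/
def mirroredFrame (a : Fin (m + 2) → E (m + 1)) : Fin (m + 1) → E (m + 1) :=
  Fin.snoc (diagonal a) (lastEdge a)

@[simp] theorem mirroredFrame_castSucc (a : Fin (m + 2) → E (m + 1)) (i : Fin m) :
    mirroredFrame a i.castSucc = diagonal a i := by
  simp [mirroredFrame]

@[simp] theorem mirroredFrame_last (a : Fin (m + 2) → E (m + 1)) :
    mirroredFrame a (Fin.last m) = lastEdge a := by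
  simp [mirroredFrame]

/-- The consecutive edges `a_{i+1} - a_i`. -/
def edge (a : Fin (m + 2) → E (m + 1)) (i : Fin (m + 1)) : E (m + 1) :=
  a i.succ - a i.castSucc

theorem diagonal_eq (a : Fin (m + 2) → E (m + 1)) (i : Fin m) :
    diagonal a i = (2 : ℝ) •
      ((EuclideanGeometry.orthogonalProjection (laterFlat a i) (a i.castSucc.castSucc) : E (m + 1))
        - a i.castSucc.castSucc) := by
  rw [diagonal, mirrored, EuclideanGeometry.reflection_apply', vsub_eq_sub, vadd_eq_add, two_smul]
  abel

theorem mem_laterFlat {a : Fin (m + 2) → E (m + 1)} {i : Fin m} {j : Fin (m + 2)}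
    (h : i.castSucc.castSucc < j) : a j ∈ laterFlat a i :=
  subset_affineSpan ℝ _ ⟨j, h, rfl⟩

theorem laterFlat_anti (a : Fin (m + 2) → E (m + 1)) {i j : Fin m} (h : i ≤ j) :
    laterFlat a j ≤ laterFlat a i :=
  affineSpan_mono ℝ (Set.image_mono fun _ hk =>
    lt_of_le_of_lt (Fin.castSucc_le_castSucc_iff.2 (Fin.castSucc_le_castSucc_iff.2 h)) hk)

theorem diagonal_mem_orthogonal (a : Fin (m + 2) → E (m + 1)) (i : Fin m) :
    diagonal a i ∈ (laterFlat a i).directionᗮ := by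
  rw [diagonal_eq]
  exact Submodule.smul_mem _ _
    (EuclideanGeometry.orthogonalProjection_vsub_mem_direction_orthogonal _ _)

/-- The foot of the altitude from a later vertex lies in a smaller flat, hence in this one, as does
the vertex itself. -/
theorem mirroredFrame_mem_direction (a : Fin (m + 2) → E (m + 1)) {i : Fin m} {j : Fin (m + 1)}
    (h : i.castSucc < j) : mirroredFrame a j ∈ (laterFlat a i).direction := by
  induction j using Fin.lastCases with
  | last =>
    rw [mirroredFrame_last]
    exact AffineSubspace.vsub_mem_direction (mem_laterFlat (Fin.castSucc_lt_last _))
      (mem_laterFlat (Fin.castSucc_lt_castSucc_iff.2 h))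
  | cast j =>
    rw [mirroredFrame_castSucc, diagonal_eq]
    refine Submodule.smul_mem _ _ (AffineSubspace.vsub_mem_direction ?_
      (mem_laterFlat (Fin.castSucc_lt_castSucc_iff.2 h)))
    exact laterFlat_anti a (Fin.castSucc_lt_castSucc_iff.1 h).le
      (EuclideanGeometry.orthogonalProjection_mem _)

theorem inner_mirroredFrame_of_lt (a : Fin (m + 2) → E (m + 1)) {i j : Fin (m + 1)} (h : i < j) :
    inner ℝ (mirroredFrame a i) (mirroredFrame a j) = 0 := by
  induction i using Fin.lastCases with
  | last => exact absurd h (Fin.le_last j).not_gt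
  | cast i =>
    rw [mirroredFrame_castSucc]
    exact Submodule.inner_left_of_mem_orthogonal (mirroredFrame_mem_direction a h)
      (diagonal_mem_orthogonal a i)

theorem pairwiseOrthogonal_mirroredFrame (a : Fin (m + 2) → E (m + 1)) :
    PairwiseOrthogonal (mirroredFrame a) := fun i j hij => by
  rcases hij.lt_or_gt with h | h
  · exact inner_mirroredFrame_of_lt a h
  · rw [real_inner_comm]; exact inner_mirroredFrame_of_lt a h

theorem wedge_edge (a : Fin (m + 2) → E (m + 1)) : wedge (edge a) = pseudoScalar a := by
  rw [pseudoScalar, ← wedgeMap_apply, ← wedgeMap_apply]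
  refine alternatingMap_eq_of_sub_mem_span_lt _ fun i => ?_
  have h : edge a i - (a i.succ - a 0) = -(a i.castSucc - a 0) := by
    rw [edge]; abel
  rw [h]
  refine Submodule.neg_mem _ ?_
  induction i using Fin.cases with
  | zero => simp
  | succ i => exact Submodule.subset_span ⟨i.castSucc, Fin.castSucc_lt_succ, rfl⟩

theorem sub_mem_span_edge (a : Fin (m + 2) → E (m + 1)) (i : Fin (m + 1)) (j : Fin (m + 2))
    (h : i.succ ≤ j) : a j - a i.succ ∈ Submodule.span ℝ (edge a '' Set.Ioi i) := by
  induction j using Fin.induction with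
  | zero => exact absurd h (Fin.succ_pos i).not_ge
  | succ j ih =>
    rcases h.eq_or_lt with h | h
    · simp [h]
    · have hij : i < j := Fin.succ_lt_succ_iff.1 h
      rw [← sub_add_sub_cancel _ (a j.castSucc)]
      exact Submodule.add_mem _ (Submodule.subset_span ⟨j, hij, rfl⟩)
        (ih (Fin.succ_le_castSucc_iff.2 hij))

theorem direction_laterFlat_le (a : Fin (m + 2) → E (m + 1)) (i : Fin m) :
    (laterFlat a i).direction ≤ Submodule.span ℝ (edge a '' Set.Ioi i.castSucc) := by
  rw [laterFlat, direction_affineSpan, vectorSpan_eq_span_vsub_set_right ℝ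
    (Set.mem_image_of_mem a (show i.castSucc.castSucc < i.castSucc.succ from
      Fin.castSucc_lt_succ)), Submodule.span_le]
  rintro _ ⟨_, ⟨j, hj, rfl⟩, rfl⟩
  exact sub_mem_span_edge a _ j (Fin.castSucc_lt_iff_succ_le.1 hj)

/-- Each `diagonal` is twice an altitude vector, and the altitude differs from the edge at the same
vertex by a vector of the later flat, spanned by later edges. The last edge is not doubled, whence
the exponent m. -/
theorem wedge_mirroredFrame (a : Fin (m + 2) → E (m + 1)) :
    wedge (mirroredFrame a) = (2 : ℝ) ^ m • pseudoScalar a := by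
  let c : Fin (m + 1) → ℝ := Fin.snoc (fun _ => 2) 1
  let u : Fin (m + 1) → E (m + 1) := Fin.snoc (fun i : Fin m =>
    (EuclideanGeometry.orthogonalProjection (laterFlat a i) (a i.castSucc.castSucc) : E (m + 1))
      - a i.castSucc.castSucc) (lastEdge a)
  have h : mirroredFrame a = fun i => c i • u i := by
    ext1 i
    induction i using Fin.lastCases with
    | last => simp [c, u]
    | cast i => simp [c, u, diagonal_eq]
  have hc : ∏ i, c i = 2 ^ m := by simp [c, Fin.prod_univ_castSucc]
  rw [h, ← wedgeMap_apply, AlternatingMap.map_smul_univ, hc, ← wedge_edge, ← wedgeMap_apply]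
  congr 1
  refine alternatingMap_eq_of_sub_mem_span_gt _ fun i => ?_
  induction i using Fin.lastCases with
  | last => simp [u, edge, lastEdge]
  | cast i =>
    simp only [u, Fin.snoc_castSucc, edge, sub_sub_sub_cancel_right]
    exact direction_laterFlat_le a i (AffineSubspace.vsub_mem_direction
      (EuclideanGeometry.orthogonalProjection_mem _) (mem_laterFlat Fin.castSucc_lt_succ))

theorem vecProd_mirroredFrame (a : Fin (m + 2) → E (m + 1)) :
    vecProd (mirroredFrame a) = (2 : ℝ) ^ m • pseudoScalar a := by
  rw [← wedge_mirroredFrame, wedge_eq_vecProd (pairwiseOrthogonal_mirroredFrame a)]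

theorem mirroredFrame_ne_zero {a : Fin (m + 2) → E (m + 1)} (h : pseudoScalar a ≠ 0)
    (i : Fin (m + 1)) : mirroredFrame a i ≠ 0 :=
  ne_zero_of_vecProd_ne_zero
    (by rw [vecProd_mirroredFrame]; exact smul_ne_zero (by positivity) h) i

theorem pseudoScalar_eq_smul (a : Fin (m + 2) → E (m + 1)) :
    pseudoScalar a = ((2 : ℝ) ^ m)⁻¹ • vecProd (mirroredFrame a) := by
  rw [vecProd_mirroredFrame, smul_smul, inv_mul_cancel₀ (by positivity), one_smul]

theorem isUnit_pseudoScalar {a : Fin (m + 2) → E (m + 1)} (h : pseudoScalar a ≠ 0) :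
    IsUnit (pseudoScalar a) := by
  rw [pseudoScalar_eq_smul]
  exact (isUnit_vecProd (mirroredFrame_ne_zero h)).smul
    (Units.mk0 (((2 : ℝ) ^ m)⁻¹) (by positivity))

/-- The increments of `f` along the vectors of the mirrored frame. -/
def increment (f : E (m + 1) → ℝ) (a : Fin (m + 2) → E (m + 1)) : Fin (m + 1) → ℝ :=
  Fin.snoc (fun i => f (mirrored a i) - f (a i.castSucc.castSucc))
    (f (a (Fin.last (m + 1))) - f (a (Fin.last m).castSucc))

theorem meanMultiDiff_eq (f : E (m + 1) → ℝ) (a : Fin (m + 2) → E (m + 1)) :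
    meanMultiDiff f a = ((2 : ℝ) ^ m)⁻¹ • ∑ i, increment f a i •
      ((-1 : ℝ) ^ (i : ℕ) • vecProd fun j => mirroredFrame a (i.succAbove j)) := by
  have h : ∀ i : Fin (m + 1), (vecProd fun j => mirroredFrame a (i.succAbove j)) =
      wedge fun j => mirroredFrame a (i.succAbove j) := fun i =>
    (wedge_eq_vecProd ((pairwiseOrthogonal_mirroredFrame a).comp
      (Fin.succAbove_right_injective))).symm
  simp only [h, meanMultiDiff, Fin.sum_univ_castSucc, smul_smul, increment, Fin.snoc_castSucc,
    Fin.snoc_last, Fin.val_castSucc, Fin.val_last, Fin.succAbove_last, mirroredFrame_castSucc,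
    mirrorBladeOmit, mirrorBlade, mul_comm]
  rfl

/-- The vector `∑ i, (Δᵢ f / |dᵢ|²) dᵢ`, where the `dᵢ` are the vectors of the mirrored frame and
`Δᵢ f` are the increments of `f` along them. -/
def secantGradient (f : E (m + 1) → ℝ) (a : Fin (m + 2) → E (m + 1)) : E (m + 1) :=
  ∑ i, increment f a i • (‖mirroredFrame a i‖ ^ 2)⁻¹ • mirroredFrame a i

theorem vec_secantGradient (f : E (m + 1) → ℝ) {a : Fin (m + 2) → E (m + 1)}
    (h : pseudoScalar a ≠ 0) :
    vec (secantGradient f a) = meanMultiDiff f a * Ring.inverse (pseudoScalar a) := by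
  rw [← (isUnit_pseudoScalar h).mul_left_inj, Ring.inverse_mul_cancel_right _ _
    (isUnit_pseudoScalar h), meanMultiDiff_eq, pseudoScalar_eq_smul, mul_smul_comm,
    secantGradient, map_sum, Finset.sum_mul]
  -- The factors 2^(-m) in the mean difference and in Δ cancel.
  congr 1
  refine Finset.sum_congr rfl fun i _ => ?_
  rw [map_smul, smul_mul_assoc, ← smul_vecProd_omit_mul_inverse
    (pairwiseOrthogonal_mirroredFrame a) (mirroredFrame_ne_zero h) i,
    Ring.inverse_mul_cancel_right _ _ (isUnit_vecProd (mirroredFrame_ne_zero h))]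

end MirroredFrame

/-! ### Convergence to the gradient -/

section Limit

/-- A ball inside Ω removes the membership conditions; taking v = x₀ then identifies g as the
gradient. -/
theorem StronglyDifferentiableAt.exists_gradient {n : ℕ} {Ω : Set (E n)} {f : E n → ℝ} {x₀ : E n}
    (hx₀ : x₀ ∈ interior Ω) (hf : StronglyDifferentiableAt Ω f x₀) :
    ∀ ε > 0, ∃ δ > 0, ∀ u v, ‖u - x₀‖ < δ → ‖v - x₀‖ < δ →
      |f u - f v - inner ℝ (∇ f x₀) (u - v)| ≤ ε * ‖u - v‖ := by
  obtain ⟨g, hg⟩ := hf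
  obtain ⟨ρ, hρ, hball⟩ := Metric.mem_nhds_iff.1 (mem_interior_iff_mem_nhds.1 hx₀)
  have key : ∀ ε > 0, ∃ δ > 0, ∀ u v, ‖u - x₀‖ < δ → ‖v - x₀‖ < δ →
      |f u - f v - inner ℝ g (u - v)| ≤ ε * ‖u - v‖ := fun ε hε => by
    obtain ⟨δ, hδ, H⟩ := hg ε hε
    refine ⟨min δ ρ, lt_min hδ hρ, fun u v hu hv => ?_⟩
    rw [lt_min_iff] at hu hv
    exact H u (hball (mem_ball_iff_norm.2 hu.2)) v (hball (mem_ball_iff_norm.2 hv.2)) hu.1 hv.1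
  have hgrad : HasGradientAt f g x₀ := by
    rw [hasGradientAt_iff_isLittleO, Asymptotics.isLittleO_iff]
    intro ε hε
    obtain ⟨δ, hδ, H⟩ := key ε hε
    filter_upwards [Metric.ball_mem_nhds x₀ hδ] with u hu
    exact H u x₀ (mem_ball_iff_norm.1 hu) (by simpa using hδ)
  rwa [hgrad.gradient]

variable {m : ℕ}

theorem sum_inner_smul_mirroredFrame {a : Fin (m + 2) → E (m + 1)} (h : pseudoScalar a ≠ 0)
    (g : E (m + 1)) :
    ∑ i, inner ℝ g (mirroredFrame a i) • (‖mirroredFrame a i‖ ^ 2)⁻¹ • mirroredFrame a i = g := by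
  have hspan := (linearIndependent_of_ne_zero_of_inner_eq_zero (𝕜 := ℝ) (mirroredFrame_ne_zero h)
    (pairwiseOrthogonal_mirroredFrame a)).span_eq_top_of_card_eq_finrank (by simp)
  refine ext_inner_right ℝ fun v => ?_
  induction (hspan ▸ Submodule.mem_top : v ∈ Submodule.span ℝ (Set.range (mirroredFrame a)))
    using Submodule.span_induction with
  | mem x hx =>
    obtain ⟨j, rfl⟩ := hx
    have hj : ‖mirroredFrame a j‖ ^ 2 ≠ 0 :=
      pow_ne_zero _ (norm_ne_zero_iff.2 (mirroredFrame_ne_zero h j))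
    rw [sum_inner, Finset.sum_eq_single j]
    · rw [real_inner_smul_left, real_inner_smul_left, real_inner_self_eq_norm_sq,
        inv_mul_cancel₀ hj, mul_one]
    · intro i _ hij
      rw [real_inner_smul_left, real_inner_smul_left, pairwiseOrthogonal_mirroredFrame a hij,
        mul_zero, mul_zero]
    · simp
  | zero => simp
  | add x y _ _ hx hy => rw [inner_add_right, inner_add_right, hx, hy]
  | smul c x _ hx => rw [real_inner_smul_right, real_inner_smul_right, hx]

theorem norm_secantGradient_sub_le {f : E (m + 1) → ℝ} {a : Fin (m + 2) → E (m + 1)}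
    (h : pseudoScalar a ≠ 0) {g : E (m + 1)} {ε : ℝ}
    (hε : ∀ i, |increment f a i - inner ℝ g (mirroredFrame a i)| ≤ ε * ‖mirroredFrame a i‖) :
    ‖secantGradient f a - g‖ ≤ (m + 1) * ε := by
  conv_lhs => rw [← sum_inner_smul_mirroredFrame h g]
  rw [secantGradient, ← Finset.sum_sub_distrib]
  refine (norm_sum_le_of_le _ (f := _) (n := fun _ => ε) fun i _ => ?_).trans (by simp)
  have hi : 0 < ‖mirroredFrame a i‖ := norm_pos_iff.2 (mirroredFrame_ne_zero h i)
  rw [← sub_smul, norm_smul, norm_smul, Real.norm_eq_abs, norm_inv, norm_pow, norm_norm]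
  calc _ ≤ ε * ‖mirroredFrame a i‖ * ((‖mirroredFrame a i‖ ^ 2)⁻¹ * ‖mirroredFrame a i‖) := by
        gcongr; exact hε i
    _ = ε := by field_simp

/-- Reflection preserves the distance to the last vertex, a point of the mirror; the triangle
inequality then uses three lengths below δ / 3. -/
theorem norm_mirrored_sub_lt {a : Fin (m + 2) → E (m + 1)} {x₀ : E (m + 1)} {δ : ℝ}
    (ha : ∀ j, ‖a j - x₀‖ < δ / 3) (i : Fin m) : ‖mirrored a i - x₀‖ < δ := by
  have h := EuclideanGeometry.dist_reflection_eq_of_mem (laterFlat a i)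
    (mem_laterFlat (Fin.castSucc_lt_last i.castSucc)) (a i.castSucc.castSucc)
  rw [← mirrored] at h
  have h1 := dist_triangle_left (mirrored a i) x₀ (a (Fin.last (m + 1)))
  have h2 := dist_triangle_right (a (Fin.last (m + 1))) (a i.castSucc.castSucc) x₀
  have h3 := ha (Fin.last (m + 1))
  have h4 := ha i.castSucc.castSucc
  rw [← dist_eq_norm] at h3 h4 ⊢
  linarith

theorem tendsto_secantGradient {Ω : Set (E (m + 1))} {f : E (m + 1) → ℝ} {x₀ : E (m + 1)}
    (hx₀ : x₀ ∈ interior Ω) (hf : StronglyDifferentiableAt Ω f x₀) :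
    Tendsto (secantGradient f) (𝓝[{a | pseudoScalar a ≠ 0}] (fun _ => x₀)) (𝓝 (∇ f x₀)) := by
  rw [Metric.tendsto_nhds]
  intro ε hε
  -- Summing m + 1 errors of size ε / (m + 2) stays strictly below ε.
  obtain ⟨δ, hδ, H⟩ := hf.exists_gradient hx₀ (ε / (m + 2)) (by positivity)
  filter_upwards [self_mem_nhdsWithin, mem_nhdsWithin_of_mem_nhds
    (Metric.ball_mem_nhds (fun _ => x₀) (show 0 < δ / 3 by positivity))] with a h ha
  have ha' : ∀ j, ‖a j - x₀‖ < δ / 3 := fun j => by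
    rw [← dist_eq_norm]; exact (dist_le_pi_dist a (fun _ => x₀) j).trans_lt (Metric.mem_ball.1 ha)
  have ha'' : ∀ j, ‖a j - x₀‖ < δ := fun j => (ha' j).trans (by linarith)
  rw [dist_eq_norm]
  refine (norm_secantGradient_sub_le h (ε := ε / (m + 2)) fun i => ?_).trans_lt ?_
  · induction i using Fin.lastCases with
    | last =>
      simpa only [increment, Fin.snoc_last, mirroredFrame_last, lastEdge] using H _ _ (ha'' _) (ha'' _)
    | cast i =>
      simpa only [increment, Fin.snoc_castSucc, mirroredFrame_castSucc, diagonal]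
        using H _ _ (norm_mirrored_sub_lt ha' i) (ha'' _)
  · rw [← mul_div_assoc, div_lt_iff₀ (by positivity)]
    nlinarith

end Limit

end CliffordSecant

end

/-- In dimension `n = m + 1`: on nondegenerate simplices the pseudo-scalar `Δ` is invertible, the
Clifford quotient of the mean multi-difference pseudo-vector of `f` by `Δ` is a vector `r a`, and
this vector converges to the gradient of `f` at `x₀` as the nondegenerate simplex contracts
to `x₀`. -/
theorem mainTheorem1 (m : ℕ) (Ω : Set (CliffordSecant.E (m + 1)))
    (f : CliffordSecant.E (m + 1) → ℝ) (x₀ : CliffordSecant.E (m + 1))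
    (hx₀ : x₀ ∈ interior Ω) (hf : CliffordSecant.StronglyDifferentiableAt Ω f x₀) :
    ∃ r : (Fin (m + 2) → CliffordSecant.E (m + 1)) → CliffordSecant.E (m + 1),
      (∀ a, CliffordSecant.pseudoScalar a ≠ 0 →
        IsUnit (CliffordSecant.pseudoScalar a) ∧
        CliffordSecant.vec (r a) =
          CliffordSecant.meanMultiDiff f a * Ring.inverse (CliffordSecant.pseudoScalar a)) ∧
      Tendsto r (𝓝[{a | CliffordSecant.pseudoScalar a ≠ 0}] (fun _ => x₀))
        (𝓝 (∇ f x₀)) :=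
  ⟨CliffordSecant.secantGradient f, fun _ h => ⟨CliffordSecant.isUnit_pseudoScalar h,
    CliffordSecant.vec_secantGradient f h⟩, CliffordSecant.tendsto_secantGradient hx₀ hf⟩
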